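/- Let $A:\mathbb{N}\times\mathbb{N}\to\{0,1\}$ be an incidence matrix, $\Sigma=\{x\in\mathbb{N}^{\mathbb{N}}: A(x_j,x_{j+1})=1\ \forall j\ge 0\}$ the associated one-sided Markov shift with shift map $\sigma$ and distance $d(x,y)=\lambda^{\inf\{j:\,x_j\ne y_j\}}$ for a fixed $\lambda\in(0,1)$ (with $d(x,x)=0$), and suppose that $\Sigma$ is topologically transitive: for all $i,j\in\mathbb{N}$ there is $n\ge 0$ with $\sigma^{-n}[j]\cap[i]\neq\emptyset$, where $[i]=\{x\in\Sigma:x_0=i\}$. For $g:\Sigma\to\mathbb{R}$ put $Var_j(g)=\sup\{|g(x)-g(y)|: d(x,y)\le\lambda^j\}$; $g$ has bounded variation if $\sum_{j\ge1}Var_j(g)<\infty$, and $g$ is Hölder if there are $K>0$ and $r\in(0,1)$ with $Var_n(g)\le Kr^n$ for all $n\ge1$. Let $f:\Sigma\to\mathbb{R}$ have bounded variation and be coercive, that is, $\lim_{j\to\infty}\sup\{f(x):x\in[j]\}=-\infty$. Let $m=\sup_\mu\int f\,d\mu$ over the $\sigma$-invariant Borel probability measures $\mu$ (the integral may be $-\infty$);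 a maximizing measure is one that attains $m$. A function $V:\Sigma\to\mathbb{R}$ is a subaction if $f\le V\circ\sigma-V+m$, and it is calibrated if moreover every $x\in\Sigma$ has some $y$ with $\sigma(y)=x$ and $f(y)=V(x)-V(y)+m$. Let $\mu_{max}$ be a maximizing measure, fix $\overline{y}\in\mathrm{supp}(\mu_{max})$, and let $S_f(x)=S_f(\overline{y},x)$ be the Peierls barrier $$S_f(\overline{y},x)=\lim_{\epsilon\to0^+}\ \sup_{n\ge0}\ \sup\Big\{\sum_{j=0}^{n-1}\big(f(\sigma^j z)-m\big):\ z\in\Sigma,\ d(\overline{y},z)<\epsilon,\ \sigma^n(z)=x\Big\}.$$ Then $S_f(x)$ is a real number for every $x\in\Sigma$, and: (1) For every continuous subaction $V$ and every $x\in\Sigma$, $S_f(x)\le V(x)-V(\overline{y})$. (2) If $f$ is Hölder, then $S_f$ has bounded variation. (3) If the maximizing measure is unique, then every bounded continuous calibrated subaction $V$ satisfies $S_f(x)=V(x)-V(\overline{y})$ for all $x\in\Sigma$; in particular, any two bounded continuous calibrated subactions differ by a constant. -/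

import Mathlib

open MeasureTheory Filter Topology
open scoped ENNReal

noncomputable section

namespace CMS

/-- The one-sided countable Markov shift of the incidence matrix `A : ℕ × ℕ → {0,1}`. It carries
the subspace topology of the product of discrete spaces and the corresponding (Borel)
σ-algebra. -/
abbrev Shift (A : ℕ → ℕ → Fin 2) : Type :=
  {x : ℕ → ℕ // ∀ n, A (x n) (x (n + 1)) = 1}

variable {A : ℕ → ℕ → Fin 2}

/-- The shift map `σ(x₀x₁x₂…) = x₁x₂…`. -/
def sigma (x : Shift A) : Shift A :=
  ⟨fun n => x.1 (n + 1), fun n => x.2 (n + 1)⟩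

/-- Transitivity: for all letters `i, j` there is `n ≥ 0` with `σ⁻ⁿ[j] ∩ [i] ≠ ∅`. -/
def IsTransitive (A : ℕ → ℕ → Fin 2) : Prop :=
  ∀ i j : ℕ, ∃ n : ℕ, ∃ x : Shift A, x.1 0 = i ∧ (sigma^[n] x).1 0 = j

open Classical in
/-- The distance `d_lam(x,y) = lam ^ inf {j : x_j ≠ y_j}` (and `0` when `x = y`). -/
def d (lam : ℝ) (x y : Shift A) : ℝ :=
  if x = y then 0 else lam ^ sInf {j : ℕ | x.1 j ≠ y.1 j}

/-- `Var_j(f) = sup {|f x - f y| : d(x,y) ≤ lam ^ j}`, with values in `[0,∞]`. -/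
def var (lam : ℝ) (f : Shift A → ℝ) (j : ℕ) : ℝ≥0∞ :=
  ⨆ (x : Shift A) (y : Shift A) (_ : d lam x y ≤ lam ^ j), ENNReal.ofReal |f x - f y|

/-- Bounded variation: `∑_{j ≥ 1} Var_j(f) < ∞`. -/
def HasBoundedVariation (lam : ℝ) (f : Shift A → ℝ) : Prop :=
  ∑' j : ℕ, var lam f (j + 1) < ∞

/-- Hölder continuity: `Var_n(f) ≤ K rⁿ` for all `n ≥ 1`. -/
def IsHolder (lam : ℝ) (f : Shift A → ℝ) : Prop :=
  ∃ K r : ℝ, 0 < K ∧ 0 < r ∧ r < 1 ∧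
    ∀ n : ℕ, 1 ≤ n → var lam f n ≤ ENNReal.ofReal (K * r ^ n)

/-- Coercivity: `sup {f x : x ∈ [j]} → -∞` as `j → ∞`. -/
def IsCoercive (f : Shift A → ℝ) : Prop :=
  Tendsto (fun j : ℕ => ⨆ (x : Shift A) (_ : x.1 0 = j), (f x : EReal)) atTop (𝓝 ⊥)

/-- `μ` is a `σ`-invariant Borel probability measure. -/
def IsInvariantProb (μ : Measure (Shift A)) : Prop :=
  IsProbabilityMeasure μ ∧ MeasurePreserving sigma μ μ

/-- The integral `∫ f dμ = ∫ f⁺ dμ - ∫ f⁻ dμ` with values in `[-∞,∞]`; for `f` bounded above and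
`μ` finite the first term is finite, and the integral may be `-∞`. -/
def eintegral (f : Shift A → ℝ) (μ : Measure (Shift A)) : EReal :=
  ((∫⁻ x, ENNReal.ofReal (f x) ∂μ : ℝ≥0∞) : EReal) -
    ((∫⁻ x, ENNReal.ofReal (-f x) ∂μ : ℝ≥0∞) : EReal)

/-- `m(f) = sup {∫ f dμ : μ invariant probability}`, with values in `[-∞,∞]`. -/
def emax (f : Shift A → ℝ) : EReal :=
  ⨆ (μ : Measure (Shift A)) (_ : IsInvariantProb μ), eintegral f μ

/-- `m(f)` as a real number (the supremum is finite for coercive potentials of bounded variation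
on a transitive shift). -/
def m (f : Shift A → ℝ) : ℝ := (emax f).toReal

/-- Maximizing measures: invariant probabilities that attain the supremum `m(f)`. -/
def IsMaximizing (f : Shift A → ℝ) (μ : Measure (Shift A)) : Prop :=
  IsInvariantProb μ ∧ eintegral f μ = emax f

/-- Subactions: `f ≤ V ∘ σ - V + m(f)` pointwise. -/
def IsSubaction (f V : Shift A → ℝ) : Prop :=
  ∀ x, f x ≤ V (sigma x) - V x + m f

/-- Calibrated subactions: every `x` has a preimage at which equality holds. -/
def IsCalibrated (f V : Shift A → ℝ) : Prop :=
  IsSubaction f V ∧ ∀ x, ∃ y, sigma y = x ∧ f y = V x - V y + m f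

/-- `S_f^ε(y,x) = sup_{n ≥ 0} sup {S_n(f - m)(z) : d(y,z) < ε, σⁿ z = x}`, with values in
`[-∞,∞]`. -/
def peierlsEps (lam : ℝ) (f : Shift A → ℝ) (ε : ℝ) (y x : Shift A) : EReal :=
  ⨆ (n : ℕ) (z : Shift A) (_ : d lam y z < ε ∧ sigma^[n] z = x),
    ((birkhoffSum sigma (fun w => f w - m f) n z : ℝ) : EReal)

/-- The Peierls barrier `S_f(y,x) = lim_{ε → 0⁺} S_f^ε(y,x)`, with values in `[-∞,∞]`. As
`S_f^ε` is monotone in `ε`, the limit is the infimum over `ε > 0`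
(see `tendsto_peierlsEps`). -/
def peierls (lam : ℝ) (f : Shift A → ℝ) (y x : Shift A) : EReal :=
  ⨅ (ε : ℝ) (_ : 0 < ε), peierlsEps lam f ε y x

theorem tendsto_peierlsEps (lam : ℝ) (f : Shift A → ℝ) (y x : Shift A) :
    Tendsto (fun ε : ℝ => peierlsEps lam f ε y x) (𝓝[>] 0) (𝓝 (peierls lam f y x)) := by
  have hm : Monotone (fun ε : ℝ => peierlsEps lam f ε y x) := by
    intro a b hab
    refine iSup_mono fun n => iSup_mono fun z => iSup_le fun h => ?_
    exact le_iSup_of_le (f := fun _ : d lam y z < b ∧ sigma^[n] z = x =>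
      ((birkhoffSum sigma (fun w => f w - m f) n z : ℝ) : EReal))
      ⟨lt_of_lt_of_le h.1 hab, h.2⟩ le_rfl
  have h := hm.tendsto_nhdsGT 0
  rw [sInf_image] at h
  exact h

end CMS

end

/-!
The normalized potential is `g = f - m(f)`, and `S_n g` denotes its Birkhoff sums. Everything rests
on three facts about them.

* *Upper bound.* A periodic orbit carries an invariant measure, so its Birkhoff sum `S_n g` is
  nonpositive. By transitivity every orbit segment from the cylinder of `ybar` to `x` can be closed
  up to a periodic orbit at a cost depending only on `x`, by bounded distortion
  (`CMS.abs_birkhoffSum_sub_le_tail`). Hence the Peierls barrier is not `+∞`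
  (`CMS.exists_birkhoffSum_le`).

* *Almost optimal returns.* If `μ` is maximizing, `g` has nonnegative integral over invariant sets.
  Then every set of positive measure contains points returning to it at arbitrarily late times with
  `S_n g ≥ -δ` (`ErgodicAux.exists_return_birkhoffSum_ge`): otherwise, adding to `g` a small
  multiple of the indicator of the set would give a function of positive integral over the invariant set of
  points that visit infinitely often, with a negative Birkhoff sum at each of them, against the
  maximal ergodic theorem. Applied to cylinders around a point `ybar` of the support, this gives
  loops at `ybar` of arbitrary length and almost no cost. Followed by a path to `x` they show that
  the barrier is not `-∞`. Prepended to an arbitrary orbit segment ending at `x`, they make it so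
  long that its endpoint can be replaced by any `x'` sharing `j ≥ 1` letters with `x`; so the
  barrier varies by at most `∑_{i > j} Var_i(f)` (`CMS.coe_sub_tail_le_peierls`), which decays geometrically
  when `f` is Hölder.

* *Calibrated backward orbits.* For a subaction `V`, `S_n g z ≤ V (σⁿ z) - V z`, whence
  `S_f(x) ≤ V x - V ybar` by continuity. If `V` is bounded and calibrated, `x` has a backward orbit
  with equality throughout; along it `f` is bounded below, so by coercivity its new letters stay in a
  finite set and the orbit accumulates on a compact invariant set where `g = V ∘ σ - V`. By
  Krylov–Bogoliubov that set carries an invariant measure, which is maximizing, hence equal to `μ`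
  when the maximizing measure is unique. So the backward orbit comes arbitrarily close to `ybar`,
  which gives `S_f(x) ≥ V x - V ybar` (`CMS.IsCalibrated.coe_sub_le_peierls`).
-/

/-! ### Ergodic theory: maximal inequality, recurrence, invariant measures -/

namespace ErgodicAux

variable {X : Type*} {T : X → X} {φ : X → ℝ}

/-- `maxSum T φ n x` is the maximum of the Birkhoff sums of orders `0, …, n` at `x`, defined
through the recursion `max_{k ≤ n+1} S_k = max 0 (φ + (max_{k ≤ n} S_k) ∘ T)`. -/
def maxSum (T : X → X) (φ : X → ℝ) : ℕ → X → ℝ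
  | 0, _ => 0
  | n + 1, x => max 0 (φ x + maxSum T φ n (T x))

theorem maxSum_nonneg (n : ℕ) (x : X) : 0 ≤ maxSum T φ n x := by
  cases n
  · exact le_rfl
  · exact le_max_left _ _

theorem maxSum_le_succ (n : ℕ) (x : X) : maxSum T φ n x ≤ maxSum T φ (n + 1) x := by
  induction n generalizing x with
  | zero => exact maxSum_nonneg 1 x
  | succ n ih =>
    change max 0 (φ x + maxSum T φ n (T x)) ≤ max 0 (φ x + maxSum T φ (n + 1) (T x))
    gcongr
    exact ih _

theorem birkhoffSum_le_maxSum (n : ℕ) (x : X) : birkhoffSum T φ n x ≤ maxSum T φ n x := by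
  induction n generalizing x with
  | zero => simp [maxSum]
  | succ n ih =>
    rw [birkhoffSum_succ']
    exact le_max_of_le_right (by gcongr; exact ih _)

/-- If the Birkhoff sums of `g` at all returns to `B` after time `N` are at most `-C`, then adding a
small multiple of the indicator of `B` still leaves arbitrarily negative Birkhoff sums along the
orbit of every point of `B` that returns to `B` infinitely often: between consecutive returns
chosen after time `N`, the orbit spends at most `N` units of time in `B`. -/
theorem exists_birkhoffSum_add_indicator_le {g : X → ℝ} {B : Set X} {N : ℕ} {C c : ℝ}
    (hc : 0 ≤ c) (hcN : c * N ≤ C / 2)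
    (hB : ∀ z ∈ B, ∀ n, N ≤ n → T^[n] z ∈ B → birkhoffSum T g n z ≤ -C) (k : ℕ) {w : X}
    (hw : w ∈ B) (hfreq : ∃ᶠ n in atTop, T^[n] w ∈ B) :
    ∃ n, birkhoffSum T (fun x => g x + B.indicator (fun _ => c) x) n w ≤ -(k * (C / 2)) := by
  classical
  induction k generalizing w with
  | zero => exact ⟨0, by simp⟩
  | succ k ih =>
    have hex : ∃ n, N ≤ n ∧ T^[n] w ∈ B := frequently_atTop.1 hfreq N
    set n := Nat.find hex with hn
    obtain ⟨hNn, hnB⟩ := Nat.find_spec hex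
    have hfreq' : ∃ᶠ j in atTop, T^[j] (T^[n] w) ∈ B := by
      rw [frequently_atTop] at hfreq ⊢
      intro a
      obtain ⟨b, hb, hbB⟩ := hfreq (a + n)
      refine ⟨b - n, by omega, ?_⟩
      rwa [← Function.iterate_add_apply, Nat.sub_add_cancel (by omega)]
    obtain ⟨l, hl⟩ := ih hnB hfreq'
    refine ⟨n + l, ?_⟩
    rw [birkhoffSum_add]
    have h1 : birkhoffSum T (fun x => g x + B.indicator (fun _ => c) x) n w ≤ -(C / 2) := by
      have e : birkhoffSum T (fun x => g x + B.indicator (fun _ => c) x) n w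
          = birkhoffSum T g n w + ∑ i ∈ Finset.range n, B.indicator (fun _ => c) (T^[i] w) :=
        Finset.sum_add_distrib
      have hvis : ∑ i ∈ Finset.range n, B.indicator (fun _ => c) (T^[i] w) ≤ c * N := by
        rw [← Finset.sum_range_add_sum_Ico _ hNn]
        have h2 : ∑ i ∈ Finset.Ico N n, B.indicator (fun _ => c) (T^[i] w) = 0 := by
          refine Finset.sum_eq_zero fun i hi => Set.indicator_of_notMem (fun hiB => ?_) _
          rw [Finset.mem_Ico] at hi
          exact Nat.find_min hex hi.2 ⟨hi.1, hiB⟩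
        have h3 : ∑ i ∈ Finset.range N, B.indicator (fun _ => c) (T^[i] w)
            ≤ ∑ _i ∈ Finset.range N, c :=
          Finset.sum_le_sum fun i _ => Set.indicator_le_self' (fun _ _ => hc) _
        rw [h2, add_zero]
        refine h3.trans (le_of_eq ?_)
        simp [mul_comm]
      have := hB w hw n hNn hnB
      linarith
    push_cast
    linarith

variable [MeasurableSpace X] {μ : Measure X}

theorem integrable_maxSum (hT : MeasurePreserving T μ μ) (hφ : Integrable φ μ) (n : ℕ) :
    Integrable (maxSum T φ n) μ := by
  induction n with
  | zero => exact integrable_zero _ _ _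
  | succ n ih =>
    exact (integrable_zero X ℝ μ).sup (hφ.add (hT.integrable_comp_of_integrable ih))

theorem measurable_maxSum (hT : Measurable T) (hφ : Measurable φ) (n : ℕ) :
    Measurable (maxSum T φ n) := by
  induction n with
  | zero => exact measurable_const
  | succ n ih => exact measurable_const.max (hφ.add (ih.comp hT))

/-- The maximal ergodic theorem of Hopf, in the form needed here: if almost every point has a
positive Birkhoff sum, then the integral is nonnegative. -/
theorem integral_nonneg_of_exists_birkhoffSum_pos (hT : MeasurePreserving T μ μ)
    (hφm : Measurable φ) (hφ : Integrable φ μ)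
    (hpos : ∀ᵐ x ∂μ, ∃ n, 0 < birkhoffSum T φ n x) : 0 ≤ ∫ x, φ x ∂μ := by
  set s : ℕ → Set X := fun n => {x | 0 < maxSum T φ (n + 1) x} with hs
  have hsm : ∀ n, MeasurableSet (s n) := fun n =>
    measurableSet_lt measurable_const (measurable_maxSum hT.measurable hφm _)
  have hmono : Monotone s := monotone_nat_of_le_succ fun n x hx =>
    lt_of_lt_of_le (show 0 < maxSum T φ (n + 1) x from hx) (maxSum_le_succ _ _)
  have hunion : ∀ᵐ x ∂μ, x ∈ ⋃ n, s n := by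
    filter_upwards [hpos] with x ⟨n, hn⟩
    refine Set.mem_iUnion.2 ⟨n, ?_⟩
    exact hn.trans_le ((birkhoffSum_le_maxSum n x).trans (maxSum_le_succ _ _))
  have hlim := tendsto_setIntegral_of_monotone (μ := μ) (f := φ) hsm hmono hφ.integrableOn
  rw [setIntegral_eq_integral_of_ae_compl_eq_zero
    (by filter_upwards [hunion] with x hx h using absurd hx h)] at hlim
  refine ge_of_tendsto' hlim fun n => ?_
  have hcomp : Integrable (fun x => maxSum T φ n (T x)) μ :=
    hT.integrable_comp_of_integrable (integrable_maxSum hT hφ n)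
  have hint : ∫ x, maxSum T φ n (T x) ∂μ = ∫ x, maxSum T φ n x ∂μ := by
    have h := integral_map (μ := μ) hT.measurable.aemeasurable (f := maxSum T φ n)
      (by rw [hT.map_eq]; exact (integrable_maxSum hT hφ n).aestronglyMeasurable)
    rw [hT.map_eq] at h
    exact h.symm
  calc (0 : ℝ) ≤ ∫ x, maxSum T φ (n + 1) x ∂μ - ∫ x, maxSum T φ n x ∂μ :=
        sub_nonneg.2 (integral_mono (integrable_maxSum hT hφ n) (integrable_maxSum hT hφ _)
          fun x => maxSum_le_succ n x)
    _ = ∫ x, (maxSum T φ (n + 1) x - maxSum T φ n (T x)) ∂μ := by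
        rw [integral_sub (integrable_maxSum hT hφ _) hcomp, hint]
    _ ≤ ∫ x, (s n).indicator φ x ∂μ := by
        refine integral_mono ((integrable_maxSum hT hφ _).sub hcomp)
          (hφ.indicator (hsm n)) fun x => ?_
        by_cases hx : x ∈ s n
        · have h : 0 < max 0 (φ x + maxSum T φ n (T x)) := hx
          rw [Set.indicator_of_mem hx]
          change max 0 (φ x + maxSum T φ n (T x)) - maxSum T φ n (T x) ≤ φ x
          rcases lt_max_iff.1 h with h | h
          · exact absurd h (lt_irrefl _)
          · rw [max_eq_right h.le]; linarith
        · rw [Set.indicator_of_notMem hx]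
          have h1 : maxSum T φ (n + 1) x ≤ 0 := not_lt.1 hx
          have h2 := maxSum_nonneg (T := T) (φ := φ) n (T x)
          change maxSum T φ (n + 1) x - maxSum T φ n (T x) ≤ 0
          linarith
    _ = ∫ x in s n, φ x ∂μ := integral_indicator (hsm n)

/-- Recurrence with controlled Birkhoff sums. If `g` has nonnegative integral over every
invariant set, then every set `B` of positive measure has points that return to `B` at
arbitrarily late times with Birkhoff sum at least `-C`, for every `C > 0`. -/
theorem exists_return_birkhoffSum_ge [IsFiniteMeasure μ] (hT : MeasurePreserving T μ μ)
    {g : X → ℝ} (hgm : Measurable g) (hg : Integrable g μ)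
    (hinv : ∀ E : Set X, MeasurableSet E → T ⁻¹' E = E → 0 ≤ ∫ x in E, g x ∂μ)
    {B : Set X} (hB : MeasurableSet B) (hμB : 0 < μ B) (N : ℕ) {C : ℝ} (hC : 0 < C) :
    ∃ z ∈ B, ∃ n, N ≤ n ∧ T^[n] z ∈ B ∧ -C ≤ birkhoffSum T g n z := by
  by_contra! hcon
  -- at most `N` visits are charged `c` each, which costs at most half of `C`
  set c : ℝ := C / (2 * (N + 1)) with hcdef
  have hc : 0 < c := by positivity
  have hcN : c * N ≤ C / 2 := by
    rw [hcdef, div_mul_eq_mul_div, div_le_div_iff₀ (by positivity) (by positivity)]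
    nlinarith
  set h : X → ℝ := fun x => g x + B.indicator (fun _ => c) x with hh
  have hhm : Measurable h := hgm.add (measurable_const.indicator hB)
  have hIB : Integrable (B.indicator fun _ => c) μ := (integrable_const c).indicator hB
  have hhI : Integrable h μ := hg.add hIB
  set E : Set X := {z | ∃ᶠ n in atTop, T^[n] z ∈ B} with hE
  have hEm : MeasurableSet E := by
    have : E = limsup (fun n => T^[n] ⁻¹' B) atTop := by
      ext z
      rw [Filter.mem_limsup_iff_frequently_mem]
      rfl
    rw [this]
    exact MeasurableSet.measurableSet_limsup fun n => (hT.measurable.iterate n) hB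
  have hEinv : T ⁻¹' E = E := by
    ext z
    simp only [hE, Set.mem_preimage, Set.mem_ofPred_eq, frequently_atTop,
      ← Function.iterate_succ_apply]
    constructor
    · intro hz a
      obtain ⟨b, hb, hbB⟩ := hz a
      exact ⟨b + 1, by omega, hbB⟩
    · intro hz a
      obtain ⟨b, hb, hbB⟩ := hz (a + 1)
      refine ⟨b - 1, by omega, ?_⟩
      rwa [Nat.succ_eq_add_one, Nat.sub_add_cancel (by omega)]
  have hTE : MeasurePreserving T (μ.restrict E) (μ.restrict E) := by
    have := hT.restrict_preimage hEm
    rwa [hEinv] at this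
  have hneg : ∀ z ∈ E, ∃ n, 0 < birkhoffSum T (fun x => -h x) n z := by
    intro z hz
    obtain ⟨j, -, hj⟩ := frequently_atTop.1 hz 0
    have hjE : ∃ᶠ n in atTop, T^[n] (T^[j] z) ∈ B := by
      rw [frequently_atTop]
      intro a
      obtain ⟨b, hb, hbB⟩ := frequently_atTop.1 hz (a + j)
      refine ⟨b - j, by omega, ?_⟩
      rwa [← Function.iterate_add_apply, Nat.sub_add_cancel (by omega)]
    obtain ⟨k, hk⟩ := exists_nat_gt (birkhoffSum T h j z / (C / 2))
    rw [div_lt_iff₀ (by positivity)] at hk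
    obtain ⟨n, hn⟩ := exists_birkhoffSum_add_indicator_le (T := T) hc.le hcN
      (fun z hz n hn hnB => (hcon z hz n hn hnB).le) k hj hjE
    refine ⟨j + n, ?_⟩
    have e : birkhoffSum T (fun x => -h x) (j + n) z = -birkhoffSum T h (j + n) z :=
      Finset.sum_neg_distrib _
    rw [e, birkhoffSum_add]
    linarith
  have hmax := integral_nonneg_of_exists_birkhoffSum_pos hTE hhm.neg hhI.integrableOn.neg
    ((ae_restrict_iff' hEm).2 (Eventually.of_forall hneg))
  have hsplit : ∫ x in E, h x ∂μ = ∫ x in E, g x ∂μ + c * μ.real B := by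
    rw [hh, integral_add hg.integrableOn hIB.integrableOn, setIntegral_indicator hB,
      setIntegral_const, smul_eq_mul, mul_comm]
    congr 2
    have h1 := hT.conservative.measure_inter_frequently_image_mem_eq hB.nullMeasurableSet
    rw [Measure.real, Measure.real, Set.inter_comm]
    exact congrArg _ h1
  have hBpos : 0 < μ.real B := ENNReal.toReal_pos hμB.ne' (measure_ne_top _ _)
  have h1 : ∫ x in E, -h x ∂μ = -∫ x in E, h x ∂μ := integral_neg _
  have h2 := hinv E hEm hEinv
  have h3 : 0 < c * μ.real B := by positivity
  change 0 ≤ ∫ x in E, -h x ∂μ at hmax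
  linarith

/-- The empirical measure `(1/n) ∑_{i < n} δ_{Tⁱ x}`; the zero measure for `n = 0`. -/
noncomputable def empirical (T : X → X) (n : ℕ) (x : X) : Measure X :=
  (n : ℝ≥0∞)⁻¹ • ∑ i ∈ Finset.range n, Measure.dirac (T^[i] x)

theorem isProbabilityMeasure_empirical {n : ℕ} (hn : n ≠ 0) (x : X) :
    IsProbabilityMeasure (empirical T n x) := by
  constructor
  simp only [empirical, Measure.smul_apply, Measure.finsetSum_apply, measure_univ, smul_eq_mul,
    Finset.sum_const, Finset.card_range, nsmul_eq_mul, mul_one]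
  exact ENNReal.inv_mul_cancel (by exact_mod_cast hn) (ENNReal.natCast_ne_top n)

theorem integrable_empirical {n : ℕ} (hn : n ≠ 0) (x : X) {φ : X → ℝ} (hφ : Measurable φ) :
    Integrable φ (empirical T n x) := by
  refine Integrable.smul_measure ?_ (ENNReal.inv_ne_top.2 (by exact_mod_cast hn))
  exact integrable_finsetSum_measure.2 fun i _ =>
    integrable_dirac' hφ.stronglyMeasurable (by finiteness)

theorem integral_empirical (n : ℕ) (x : X) {φ : X → ℝ} (hφ : Measurable φ) :
    ∫ y, φ y ∂empirical T n x = birkhoffAverage ℝ T φ n x := by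
  rw [empirical, integral_smul_measure, integral_finsetSum_measure fun i _ =>
    integrable_dirac' hφ.stronglyMeasurable (by finiteness)]
  simp [birkhoffAverage, birkhoffSum, integral_dirac' _ _ hφ.stronglyMeasurable]

theorem map_empirical (hT : Measurable T) (n : ℕ) (x : X) :
    (empirical T n x).map T = empirical T n (T x) := by
  rw [empirical, Measure.map_smul, Measure.map_finset_sum hT.aemeasurable]
  simp only [empirical, Measure.map_dirac' hT, ← Function.iterate_succ_apply' T,
    Function.iterate_succ_apply]

theorem measurePreserving_empirical (hT : Measurable T) {n : ℕ} {x : X} (hx : T^[n] x = x) :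
    MeasurePreserving T (empirical T n x) (empirical T n x) := by
  refine ⟨hT, ?_⟩
  rw [map_empirical hT, empirical, empirical]
  congr 1
  cases n with
  | zero => simp
  | succ n =>
    rw [Finset.sum_range_succ, Finset.sum_range_succ']
    simp only [← Function.iterate_succ_apply T, Nat.succ_eq_add_one, hx, Function.iterate_zero,
      id_eq]

/-- Krylov–Bogoliubov: a continuous self-map of a nonempty compact metrizable space has an
invariant probability measure. -/
theorem exists_invariant_probabilityMeasure {K : Type*} [TopologicalSpace K] [CompactSpace K]
    [TopologicalSpace.MetrizableSpace K] [MeasurableSpace K] [BorelSpace K] [Nonempty K]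
    {T : K → K} (hT : Continuous T) :
    ∃ ν : Measure K, IsProbabilityMeasure ν ∧ MeasurePreserving T ν ν := by
  let _ := TopologicalSpace.metrizableSpaceMetric K
  obtain ⟨x⟩ := ‹Nonempty K›
  let P : K → ℕ → ProbabilityMeasure K := fun x n =>
    ⟨empirical T (n + 1) x, isProbabilityMeasure_empirical (Nat.succ_ne_zero n) x⟩
  let U : Ultrafilter (ProbabilityMeasure K) := (hyperfilter ℕ).map (P x)
  have hU : Tendsto (P x) (hyperfilter ℕ) (𝓝 U.lim) := U.le_nhds_lim
  have hU' := ((ProbabilityMeasure.continuous_map hT).tendsto _).comp hU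
  refine ⟨(U.lim : Measure K), inferInstance, hT.measurable, ?_⟩
  refine ext_of_forall_integral_eq_of_IsFiniteMeasure fun φ => ?_
  have h1 := (ProbabilityMeasure.tendsto_iff_forall_integral_tendsto.1 hU) φ
  have h2 := (ProbabilityMeasure.tendsto_iff_forall_integral_tendsto.1 hU') φ
  have hdiff := h2.sub h1
  have hφ : Measurable φ := φ.continuous.measurable
  have hzero : Tendsto (fun n : ℕ => birkhoffAverage ℝ T φ (n + 1) (T x)
      - birkhoffAverage ℝ T φ (n + 1) x) (hyperfilter ℕ) (𝓝 0) := by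
    have h := tendsto_birkhoffAverage_apply_sub_birkhoffAverage' (𝕜 := ℝ) (f := T) (g := φ)
      φ.isBounded_range x
    refine ((tendsto_add_atTop_iff_nat 1).2 h).mono_left ?_
    rw [← Nat.cofinite_eq_atTop]
    exact hyperfilter_le_cofinite
  refine sub_eq_zero.1 (tendsto_nhds_unique (hdiff.congr fun n => ?_) hzero)
  · change ∫ y, φ y ∂((empirical T (n + 1) x).map T) - ∫ y, φ y ∂(empirical T (n + 1) x) = _
    rw [map_empirical hT.measurable, integral_empirical _ _ hφ, integral_empirical _ _ hφ]

end ErgodicAux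

/-! ### Cylinders, splicing of orbits, distortion -/

namespace CMS

variable {A : ℕ → ℕ → Fin 2} {lam : ℝ} {f : Shift A → ℝ}

/-- The points `x` and `y` have the same first `k` letters. -/
def Agree (k : ℕ) (x y : Shift A) : Prop := ∀ i < k, x.1 i = y.1 i

theorem Agree.symm {k : ℕ} {x y : Shift A} (h : Agree k x y) : Agree k y x :=
  fun i hi => (h i hi).symm

theorem Agree.trans {k : ℕ} {x y z : Shift A} (h : Agree k x y) (h' : Agree k y z) :
    Agree k x z := fun i hi => (h i hi).trans (h' i hi)

theorem Agree.mono {k l : ℕ} (hkl : k ≤ l) {x y : Shift A} (h : Agree l x y) : Agree k x y :=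
  fun i hi => h i (hi.trans_le hkl)

theorem sigma_iterate_apply (n : ℕ) (x : Shift A) (i : ℕ) :
    (sigma^[n] x).1 i = x.1 (i + n) := by
  induction n generalizing x with
  | zero => rfl
  | succ n ih =>
    rw [Function.iterate_succ_apply, ih]
    rfl

theorem Agree.iterate {n k : ℕ} {x y : Shift A} (h : Agree (n + k) x y) :
    Agree k (sigma^[n] x) (sigma^[n] y) := fun i hi => by
  rw [sigma_iterate_apply, sigma_iterate_apply]
  exact h _ (by omega)

theorem d_le_pow_of_agree (h0 : 0 < lam) (h1 : lam < 1) {k : ℕ} {x y : Shift A}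
    (h : Agree k x y) : d lam x y ≤ lam ^ k := by
  classical
  unfold d
  split_ifs with hxy
  · positivity
  · refine pow_le_pow_of_le_one h0.le h1.le (le_csInf ?_ ?_)
    · by_contra hemp
      refine hxy (Subtype.ext (funext fun j => ?_))
      by_contra hj
      exact hemp ⟨j, hj⟩
    · intro j hj
      by_contra hjk
      exact hj (h j (not_le.1 hjk))

theorem agree_of_d_le_pow (h0 : 0 < lam) (h1 : lam < 1) {k : ℕ} {x y : Shift A}
    (h : d lam x y ≤ lam ^ k) : Agree k x y := by
  classical
  unfold d at h
  split_ifs at h with hxy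
  · exact fun i _ => by rw [hxy]
  · have hle := (pow_le_pow_iff_right_of_lt_one₀ h0 h1).1 h
    intro i hi
    by_contra hne
    exact absurd (Nat.sInf_le (show i ∈ {j : ℕ | x.1 j ≠ y.1 j} from hne)) (by omega)

theorem isClopen_setOf_agree (k : ℕ) (x : Shift A) : IsClopen {z | Agree k x z} := by
  have : {z | Agree k x z} = ⋂ i ∈ Finset.range k, (fun z : Shift A => z.1 i) ⁻¹' {x.1 i} := by
    ext z
    simp [Agree, eq_comm]
  rw [this]
  refine isClopen_biInter_finset fun i _ => (isClopen_discrete _).preimage ?_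
  exact (continuous_apply i).comp continuous_subtype_val

theorem exists_agree_subset {x : Shift A} {U : Set (Shift A)} (hU : U ∈ 𝓝 x) :
    ∃ k, ∀ z, Agree k x z → z ∈ U := by
  obtain ⟨W, hW, hWU⟩ := mem_nhds_subtype _ _ _ |>.1 hU
  obtain ⟨_, ⟨y, k, rfl⟩, hxy, hsub⟩ :=
    (PiNat.isTopologicalBasis_cylinders (fun _ : ℕ => ℕ)).mem_nhds_iff.1 hW
  refine ⟨k, fun z hz => hWU (hsub ?_)⟩
  rw [PiNat.mem_cylinder_iff] at hxy ⊢
  exact fun i hi => (hz i hi).symm.trans (hxy i hi)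

theorem continuous_sigma : Continuous (sigma : Shift A → Shift A) := by
  refine Continuous.subtype_mk (f := fun (x : Shift A) n => x.1 (n + 1)) ?_ _
  exact continuous_pi fun n => (continuous_apply (n + 1)).comp continuous_subtype_val

/-- Splicing: the first `n` letters of `x` followed by `y`, when `y` starts with the letter at
position `n` of `x`. -/
theorem exists_splice (n : ℕ) (x y : Shift A) (h : x.1 n = y.1 0) :
    ∃ z : Shift A, sigma^[n] z = y ∧ ∀ k, Agree k (sigma^[n] x) y → Agree (n + k) x z := by
  have hz : ∀ i, A (if i < n then x.1 i else y.1 (i - n))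
      (if i + 1 < n then x.1 (i + 1) else y.1 (i + 1 - n)) = 1 := by
    intro i
    rcases lt_trichotomy (i + 1) n with hi | hi | hi
    · rw [if_pos (by omega), if_pos hi]
      exact x.2 i
    · subst hi
      rw [if_pos (by omega), if_neg (by omega), Nat.sub_self, ← h]
      exact x.2 i
    · rw [if_neg (by omega), if_neg (by omega), Nat.sub_add_comm (by omega)]
      exact y.2 _
  refine ⟨⟨fun i => if i < n then x.1 i else y.1 (i - n), hz⟩, ?_, fun k hk i hi => ?_⟩
  · refine Subtype.ext (funext fun i => ?_)
    rw [sigma_iterate_apply]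
    simp
  · by_cases hin : i < n
    · simp [hin]
    · have := hk (i - n) (by omega)
      rw [sigma_iterate_apply, Nat.sub_add_cancel (by omega)] at this
      simp [hin, this]

theorem exists_periodic {n : ℕ} (hn : 0 < n) (w : Shift A) (h : w.1 n = w.1 0) :
    ∃ p : Shift A, sigma^[n] p = p ∧ Agree n w p := by
  refine ⟨⟨fun i => w.1 (i % n), fun i => ?_⟩, ?_, fun i hi => ?_⟩
  · change A (w.1 (i % n)) (w.1 ((i + 1) % n)) = 1
    rw [← Nat.mod_add_mod]
    rcases (show i % n + 1 ≤ n from Nat.mod_lt i hn).lt_or_eq with hi | hi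
    · rw [Nat.mod_eq_of_lt hi]
      exact w.2 _
    · have hstep := w.2 (i % n)
      rw [hi] at hstep
      rwa [hi, Nat.mod_self, ← h]
  · refine Subtype.ext (funext fun i => ?_)
    rw [sigma_iterate_apply]
    simp
  · simp [Nat.mod_eq_of_lt hi]

theorem IsTransitive.exists_path (hA : IsTransitive A) (i j : ℕ) :
    ∃ (n : ℕ) (x : Shift A), x.1 0 = i ∧ x.1 n = j := by
  obtain ⟨n, x, hi, hj⟩ := hA i j
  rw [sigma_iterate_apply, zero_add] at hj
  exact ⟨n, x, hi, hj⟩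

theorem var_succ_ne_top (hvar : HasBoundedVariation lam f) (j : ℕ) :
    var lam f (j + 1) ≠ ∞ := ENNReal.ne_top_of_tsum_ne_top hvar.ne j

theorem summable_var (hvar : HasBoundedVariation lam f) :
    Summable fun j => (var lam f (j + 1)).toReal := ENNReal.summable_toReal hvar.ne

/-- The tail `∑_{j > k} Var_j(f)` of the series of variations. -/
noncomputable def tail (lam : ℝ) (f : Shift A → ℝ) (k : ℕ) : ℝ :=
  ∑' i : ℕ, (var lam f (i + k + 1)).toReal

theorem tendsto_tail (lam : ℝ) (f : Shift A → ℝ) :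
    Tendsto (tail lam f) atTop (𝓝 0) :=
  tendsto_sum_nat_add fun j => (var lam f (j + 1)).toReal

theorem abs_sub_le_var (h0 : 0 < lam) (h1 : lam < 1) (hvar : HasBoundedVariation lam f) {k : ℕ}
    {x y : Shift A} (h : Agree (k + 1) x y) : |f x - f y| ≤ (var lam f (k + 1)).toReal := by
  rw [← ENNReal.ofReal_le_iff_le_toReal (var_succ_ne_top hvar k)]
  exact le_iSup_of_le x (le_iSup_of_le y (le_iSup_of_le (d_le_pow_of_agree h0 h1 h) le_rfl))

/-- Bounded distortion: Birkhoff sums of order `n` along points with the same first `n + k`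
letters differ by at most the `k`-th tail of the series of variations. -/
theorem abs_birkhoffSum_sub_le_tail (h0 : 0 < lam) (h1 : lam < 1)
    (hvar : HasBoundedVariation lam f) {n k : ℕ} {x y : Shift A} (h : Agree (n + k) x y) :
    |birkhoffSum sigma f n x - birkhoffSum sigma f n y| ≤ tail lam f k := by
  rw [birkhoffSum, birkhoffSum, ← Finset.sum_sub_distrib]
  refine (Finset.abs_sum_le_sum_abs _ _).trans ?_
  have hstep : ∀ i ∈ Finset.range n, |f (sigma^[i] x) - f (sigma^[i] y)|
      ≤ (var lam f (n - 1 - i + k + 1)).toReal := by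
    intro i hi
    rw [Finset.mem_range] at hi
    refine abs_sub_le_var h0 h1 hvar (Agree.iterate ?_)
    rwa [show i + (n - 1 - i + k + 1) = n + k by omega]
  refine (Finset.sum_le_sum hstep).trans ?_
  rw [Finset.sum_range_reflect (fun i => (var lam f (i + k + 1)).toReal)]
  exact ((summable_nat_add_iff k).2 (summable_var hvar)).sum_le_tsum _
    fun _ _ => ENNReal.toReal_nonneg

theorem HasBoundedVariation.continuous (h0 : 0 < lam) (h1 : lam < 1)
    (hvar : HasBoundedVariation lam f) : Continuous f := by
  refine continuous_iff_continuousAt.2 fun x => Metric.tendsto_nhds.2 fun ε hε => ?_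
  obtain ⟨k, hk⟩ := ((summable_var hvar).tendsto_atTop_zero.eventually_lt_const hε).exists
  filter_upwards [(isClopen_setOf_agree (k + 1) x).isOpen.mem_nhds (fun i _ => rfl)] with z hz
  rw [Real.dist_eq]
  exact (abs_sub_le_var h0 h1 hvar (Agree.symm hz)).trans_lt hk

/-- A coercive function is large only on finitely many cylinders of length one. -/
theorem IsCoercive.exists_forall_lt (hcoer : IsCoercive f) (c : ℝ) :
    ∃ J : ℕ, ∀ x : Shift A, c ≤ f x → x.1 0 < J := by
  have h : ∀ᶠ j : ℕ in atTop, (⨆ (x : Shift A) (_ : x.1 0 = j), (f x : EReal)) < (c : EReal) :=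
    hcoer.eventually_lt_const (EReal.bot_lt_coe c)
  obtain ⟨J, hJ⟩ := eventually_atTop.1 h
  refine ⟨J, fun x hx => ?_⟩
  by_contra hlt
  have h1 := hJ (x.1 0) (not_lt.1 hlt)
  have h2 : (f x : EReal) ≤ ⨆ (z : Shift A) (_ : z.1 0 = x.1 0), (f z : EReal) :=
    le_iSup₂_of_le x rfl le_rfl
  exact absurd (EReal.coe_lt_coe_iff.1 (h2.trans_lt h1)) (not_lt.2 hx)

theorem IsCoercive.exists_le (h0 : 0 < lam) (h1 : lam < 1) (hA : IsTransitive A)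
    (hcoer : IsCoercive f) (hvar : HasBoundedVariation lam f) : ∃ M : ℝ, ∀ x, f x ≤ M := by
  obtain ⟨J, hJ⟩ := hcoer.exists_forall_lt 0
  choose _ z hz _ using fun j => hA.exists_path j j
  set v := (var lam f 1).toReal
  refine ⟨∑ j ∈ Finset.range J, |f (z j)| + v, fun x => ?_⟩
  have hv : 0 ≤ v := ENNReal.toReal_nonneg
  have hsum : 0 ≤ ∑ j ∈ Finset.range J, |f (z j)| := Finset.sum_nonneg fun _ _ => abs_nonneg _
  rcases le_or_gt 0 (f x) with hx | hx
  · have h2 : |f (z (x.1 0))| ≤ ∑ j ∈ Finset.range J, |f (z j)| :=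
      Finset.single_le_sum (f := fun j => |f (z j)|) (fun _ _ => abs_nonneg _)
        (Finset.mem_range.2 (hJ x hx))
    have h3 : |f x - f (z (x.1 0))| ≤ v := by
      refine abs_sub_le_var h0 h1 hvar fun i hi => ?_
      obtain rfl : i = 0 := by omega
      exact (hz _).symm
    linarith [abs_le.1 h3, le_abs_self (f (z (x.1 0)))]
  · linarith

theorem birkhoffSum_sub_const (f : Shift A → ℝ) (c : ℝ) (n : ℕ) (x : Shift A) :
    birkhoffSum sigma (fun w => f w - c) n x = birkhoffSum sigma f n x - n * c := by
  simp [birkhoffSum, Finset.sum_sub_distrib]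

theorem abs_birkhoffSum_sub_const_le_tail (h0 : 0 < lam) (h1 : lam < 1)
    (hvar : HasBoundedVariation lam f) (c : ℝ) {n k : ℕ} {x y : Shift A}
    (h : Agree (n + k) x y) :
    |birkhoffSum sigma (fun w => f w - c) n x - birkhoffSum sigma (fun w => f w - c) n y|
      ≤ tail lam f k := by
  rw [birkhoffSum_sub_const, birkhoffSum_sub_const, sub_sub_sub_cancel_right]
  exact abs_birkhoffSum_sub_le_tail h0 h1 hvar h

/-! ### The maximal integral -/

theorem eintegral_eq_integral {ν : Measure (Shift A)} (hf : Integrable f ν) :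
    eintegral f ν = ((∫ x, f x ∂ν : ℝ) : EReal) := by
  have h1 : ∫⁻ x, ENNReal.ofReal (f x) ∂ν ≠ ∞ := hf.lintegral_lt_top.ne
  have h2 : ∫⁻ x, ENNReal.ofReal (-f x) ∂ν ≠ ∞ := hf.neg.lintegral_lt_top.ne
  rw [integral_eq_lintegral_pos_part_sub_lintegral_neg_part hf, eintegral, EReal.coe_sub,
    EReal.coe_ennreal_toReal h1, EReal.coe_ennreal_toReal h2]

theorem lintegral_ofReal_ne_top {M : ℝ} (hM : ∀ x, f x ≤ M) (ν : Measure (Shift A))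
    [IsProbabilityMeasure ν] : ∫⁻ x, ENNReal.ofReal (f x) ∂ν ≠ ∞ := by
  refine ne_top_of_le_ne_top
    (b := ∫⁻ _, ENNReal.ofReal M ∂ν) ?_
    (lintegral_mono fun x => ENNReal.ofReal_le_ofReal (hM x))
  simp

theorem integrable_of_eintegral_ne_bot {M : ℝ} (hM : ∀ x, f x ≤ M) (hf : Measurable f)
    {ν : Measure (Shift A)} [IsProbabilityMeasure ν] (h : eintegral f ν ≠ ⊥) :
    Integrable f ν := by
  have h1 := lintegral_ofReal_ne_top hM ν
  have h2 : ∫⁻ x, ENNReal.ofReal (-f x) ∂ν ≠ ∞ := by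
    intro htop
    refine h ?_
    rw [eintegral, htop, EReal.coe_ennreal_top, EReal.sub_top]
  refine ⟨hf.aestronglyMeasurable, ?_⟩
  rw [hasFiniteIntegral_iff_norm]
  refine lt_of_le_of_lt (lintegral_mono (g := fun x => ENNReal.ofReal (f x) +
    ENNReal.ofReal (-f x)) fun x => ?_) ?_
  · rw [Real.norm_eq_abs]
    rcases abs_choice (f x) with hx | hx <;> rw [hx]
    · exact le_self_add
    · exact le_add_self
  · rw [lintegral_add_left hf.ennreal_ofReal]
    exact ENNReal.add_lt_top.2 ⟨h1.lt_top, h2.lt_top⟩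

theorem exists_isInvariantProb_integrable (hA : IsTransitive A) (hf : Measurable f) :
    ∃ ν : Measure (Shift A), IsInvariantProb ν ∧ Integrable f ν := by
  obtain ⟨n, x, hx0, hxn⟩ := hA.exists_path 0 1
  obtain ⟨l, y, hy0, hyl⟩ := hA.exists_path 1 0
  obtain ⟨w, hw, hag⟩ := exists_splice n x y (hxn.trans hy0.symm)
  have hn : n ≠ 0 := by
    rintro rfl
    omega
  have hw0 : w.1 0 = 0 := by
    rw [← hag 0 (fun i hi => absurd hi (Nat.not_lt_zero i)) 0 (by omega), hx0]
  have hwl : w.1 (l + n) = 0 := by rw [← sigma_iterate_apply, hw, hyl]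
  obtain ⟨p, hp, -⟩ := exists_periodic (n := l + n) (by omega) w (hwl.trans hw0.symm)
  exact ⟨_, ⟨ErgodicAux.isProbabilityMeasure_empirical (by omega) p,
    ErgodicAux.measurePreserving_empirical continuous_sigma.measurable hp⟩,
    ErgodicAux.integrable_empirical (by omega) p hf⟩

theorem emax_eq_m {M : ℝ} (hM : ∀ x, f x ≤ M) (hA : IsTransitive A) (hf : Measurable f) :
    emax f = (m f : EReal) := by
  refine (EReal.coe_toReal ?_ ?_).symm
  · refine ne_top_of_le_ne_top (EReal.coe_ne_top M) (iSup₂_le fun ν hν => ?_)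
    have := hν.1
    by_cases hbot : eintegral f ν = ⊥
    · rw [hbot]
      exact bot_le
    · have hint := integrable_of_eintegral_ne_bot hM hf hbot
      rw [eintegral_eq_integral hint, EReal.coe_le_coe_iff]
      refine (integral_mono hint (integrable_const M) hM).trans ?_
      simp
  · obtain ⟨ν, hν, hint⟩ := exists_isInvariantProb_integrable hA hf
    refine ne_bot_of_le_ne_bot (EReal.coe_ne_bot (∫ x, f x ∂ν)) ?_
    rw [← eintegral_eq_integral hint]
    exact le_iSup₂_of_le ν hν le_rfl

theorem integral_le_m (hm : emax f = (m f : EReal)) {ν : Measure (Shift A)}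
    (hν : IsInvariantProb ν) (hint : Integrable f ν) : ∫ x, f x ∂ν ≤ m f := by
  rw [← EReal.coe_le_coe_iff, ← eintegral_eq_integral hint, ← hm]
  exact le_iSup₂_of_le ν hν le_rfl

theorem birkhoffSum_le_of_periodic (hm : emax f = (m f : EReal)) (hf : Measurable f) {n : ℕ}
    (hn : n ≠ 0) {p : Shift A} (hp : sigma^[n] p = p) : birkhoffSum sigma f n p ≤ n * m f := by
  have h := integral_le_m hm ⟨ErgodicAux.isProbabilityMeasure_empirical hn p,
    ErgodicAux.measurePreserving_empirical continuous_sigma.measurable hp⟩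
    (ErgodicAux.integrable_empirical hn p hf)
  rw [ErgodicAux.integral_empirical _ _ hf, birkhoffAverage, smul_eq_mul, inv_mul_le_iff₀
    (by positivity)] at h
  exact h

/-- For a maximizing measure, `f - m(f)` has nonnegative integral over every invariant set:
otherwise the normalized restriction to the complement would have an integral larger than
`m(f)`. -/
theorem setIntegral_sub_m_nonneg (hm : emax f = (m f : EReal)) {μ : Measure (Shift A)}
    (hμ : IsMaximizing f μ) (hint : Integrable f μ) {E : Set (Shift A)} (hE : MeasurableSet E)
    (hinv : sigma ⁻¹' E = E) : 0 ≤ ∫ x in E, (f x - m f) ∂μ := by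
  have := hμ.1.1
  have hint' : Integrable (fun x => f x - m f) μ := hint.sub (integrable_const _)
  have htot : ∫ x, (f x - m f) ∂μ = 0 := by
    have h := hμ.2
    rw [hm, eintegral_eq_integral hint, EReal.coe_eq_coe_iff] at h
    rw [integral_sub hint (integrable_const _), h]
    simp
  have hle : ∫ x in Eᶜ, (f x - m f) ∂μ ≤ 0 := by
    by_cases hz : μ Eᶜ = 0
    · rw [Measure.restrict_eq_zero.2 hz, integral_zero_measure]
    have hcond : IsInvariantProb (ProbabilityTheory.cond μ Eᶜ) := by
      refine ⟨ProbabilityTheory.cond_isProbabilityMeasure hz, ?_⟩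
      have h := hμ.1.2.restrict_preimage hE.compl
      rw [Set.preimage_compl, hinv] at h
      exact h.smul_measure _
    have hi : Integrable f (ProbabilityTheory.cond μ Eᶜ) :=
      hint.integrableOn.smul_measure (ENNReal.inv_ne_top.2 hz)
    have hprob := hcond.1
    have h := integral_le_m hm hcond hi
    have h0 : ∫ x, (f x - m f) ∂(ProbabilityTheory.cond μ Eᶜ) ≤ 0 := by
      rw [integral_sub hi (integrable_const _)]
      simpa using h
    rw [ProbabilityTheory.cond, integral_smul_measure, smul_eq_mul] at h0
    have hpos : 0 < ((μ Eᶜ)⁻¹).toReal :=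
      ENNReal.toReal_pos (ENNReal.inv_ne_zero.2 (measure_ne_top _ _)) (ENNReal.inv_ne_top.2 hz)
    exact nonpos_of_mul_nonpos_right h0 hpos
  have := integral_add_compl hE hint'
  linarith

end CMS

/-! ### The Peierls barrier -/

namespace CMS

variable {A : ℕ → ℕ → Fin 2} {lam : ℝ} {f : Shift A → ℝ}

/-- A real number `a` is at most the Peierls barrier iff, up to arbitrarily small errors, it is
bounded by Birkhoff sums along orbit segments that start arbitrarily close to `y` and end at
`x`. -/
theorem coe_le_peierls_iff (h0 : 0 < lam) (h1 : lam < 1) {y x : Shift A} {a : ℝ} :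
    (a : EReal) ≤ peierls lam f y x ↔ ∀ N : ℕ, ∀ δ : ℝ, 0 < δ → ∃ (n : ℕ) (z : Shift A),
      Agree N y z ∧ sigma^[n] z = x ∧ a - δ ≤ birkhoffSum sigma (fun w => f w - m f) n z := by
  constructor
  · intro h N δ hδ
    have h2 : ((a - δ : ℝ) : EReal) < peierlsEps lam f (lam ^ N) y x :=
      (EReal.coe_lt_coe_iff.2 (sub_lt_self a hδ)).trans_le
        (h.trans (iInf₂_le _ (pow_pos h0 N)))
    simp only [peierlsEps, lt_iSup_iff] at h2
    obtain ⟨n, z, ⟨hz, hn⟩, hlt⟩ := h2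
    exact ⟨n, z, agree_of_d_le_pow h0 h1 hz.le, hn, (EReal.coe_lt_coe_iff.1 hlt).le⟩
  · intro h
    refine le_iInf₂ fun ε hε => ?_
    obtain ⟨N, hN⟩ := exists_pow_lt_of_lt_one hε h1
    refine EReal.ge_of_forall_gt_iff_ge.1 fun b hb => ?_
    obtain ⟨n, z, hag, hn, hle⟩ := h N (a - b) (sub_pos.2 (EReal.coe_lt_coe_iff.1 hb))
    refine le_trans (EReal.coe_le_coe_iff.2 ?_) (le_iSup_of_le n (le_iSup_of_le z
      (le_iSup_of_le ⟨(d_le_pow_of_agree h0 h1 hag).trans_lt hN, hn⟩ le_rfl)))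
    linarith

/-- Birkhoff sums of `f - m(f)` along orbit segments from the cylinder of the first letter of `y`
to `x` are bounded above: closing the segment up through a fixed path from `x` back to that
cylinder gives a periodic orbit, whose Birkhoff sum is nonpositive. -/
theorem exists_birkhoffSum_le (h0 : 0 < lam) (h1 : lam < 1) (hA : IsTransitive A)
    (hvar : HasBoundedVariation lam f) (hm : emax f = (m f : EReal)) (y x : Shift A) :
    ∃ C : ℝ, ∀ (n : ℕ) (z : Shift A), y.1 0 = z.1 0 → sigma^[n] z = x →
      birkhoffSum sigma (fun w => f w - m f) n z ≤ C := by
  obtain ⟨k, q, hq0, hqk⟩ := hA.exists_path (x.1 0) (y.1 0)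
  refine ⟨tail lam f 0 + tail lam f 0 - birkhoffSum sigma (fun w => f w - m f) k q,
    fun n z hyz hn => ?_⟩
  have hzn : z.1 n = q.1 0 := by rw [hq0, ← hn, sigma_iterate_apply, zero_add]
  obtain ⟨w, hw, hag⟩ := exists_splice n z q hzn
  have hag1 : Agree (n + 1) z w := hag 1 fun i hi => by
    obtain rfl : i = 0 := by omega
    rw [sigma_iterate_apply, zero_add, hzn]
  have hzw := abs_birkhoffSum_sub_const_le_tail h0 h1 hvar (m f)
    (n := n) (k := 0) (hag1.mono (Nat.le_succ _))
  have hwsum : birkhoffSum sigma (fun w => f w - m f) (n + k) w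
      = birkhoffSum sigma (fun w => f w - m f) n w
        + birkhoffSum sigma (fun w => f w - m f) k q := by
    rw [birkhoffSum_add, hw]
  have hwper : birkhoffSum sigma (fun w => f w - m f) (n + k) w ≤ tail lam f 0 := by
    rcases Nat.eq_zero_or_pos (n + k) with hz | hpos
    · rw [hz, birkhoffSum_zero]
      exact tsum_nonneg fun _ => ENNReal.toReal_nonneg
    · have hclose : w.1 (n + k) = w.1 0 := by
        rw [add_comm, ← sigma_iterate_apply, hw, hqk, hyz]
        exact hag1 0 (by omega)
      obtain ⟨p, hp, hwp⟩ := exists_periodic hpos w hclose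
      have h2 := abs_birkhoffSum_sub_const_le_tail h0 h1 hvar (m f) (n := n + k) (k := 0) hwp
      have h3 := birkhoffSum_le_of_periodic hm (hvar.continuous h0 h1).measurable hpos.ne' hp
      have h4 := birkhoffSum_sub_const f (m f) (n + k) p
      linarith [abs_le.1 h2]
  linarith [abs_le.1 hzw]

/-- The point `y` has almost optimal returns: arbitrarily close to it there are orbit segments,
starting and ending there and arbitrarily long, along which the Birkhoff sum of `f - m(f)` is at
least `-δ`, for every `δ > 0`. -/
def HasOptimalReturns (f : Shift A → ℝ) (y : Shift A) : Prop :=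
  ∀ N : ℕ, ∀ δ : ℝ, 0 < δ → ∃ (p : Shift A) (n : ℕ), N ≤ n ∧ Agree N y p ∧
    Agree N y (sigma^[n] p) ∧ -δ ≤ birkhoffSum sigma (fun w => f w - m f) n p

/-- Every point of the support of a maximizing measure has almost optimal returns. -/
theorem IsMaximizing.hasOptimalReturns {M : ℝ} (hM : ∀ x, f x ≤ M) (hf : Measurable f)
    (hm : emax f = (m f : EReal)) {μ : Measure (Shift A)} (hμ : IsMaximizing f μ) {y : Shift A}
    (hy : y ∈ μ.support) : HasOptimalReturns f y := by
  intro N δ hδ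
  have := hμ.1.1
  have hint : Integrable f μ := integrable_of_eintegral_ne_bot hM hf (by
    rw [hμ.2, hm]
    exact EReal.coe_ne_bot _)
  have hB := isClopen_setOf_agree N y
  have hpos : 0 < μ {z | Agree N y z} :=
    (Measure.mem_support_iff_forall y).1 hy _ (hB.isOpen.mem_nhds fun i _ => rfl)
  obtain ⟨p, hp, n, hn, hnp, hle⟩ := ErgodicAux.exists_return_birkhoffSum_ge hμ.1.2
    (hf.sub measurable_const) (hint.sub (integrable_const (m f)))
    (fun E hE hinv => setIntegral_sub_m_nonneg hm hμ hint hE hinv) hB.isOpen.measurableSet hpos N hδ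
  exact ⟨p, n, hn, hp, hnp, hle⟩

/-- An orbit segment that starts close to `y` can be preceded by a long almost-optimal loop at
`y`, at an arbitrarily small cost. -/
theorem exists_prepend_return (h0 : 0 < lam) (h1 : lam < 1) (hvar : HasBoundedVariation lam f)
    {y : Shift A} (hret : HasOptimalReturns f y)
    {N k : ℕ} (hk : 0 < k) (hkN : k ≤ N) {δ : ℝ} (hδ : 0 < δ) {z : Shift A} (hz : Agree k y z) :
    ∃ (l : ℕ) (u : Shift A), N ≤ l ∧ Agree N y u ∧ sigma^[l] u = z ∧
      -δ - tail lam f k ≤ birkhoffSum sigma (fun w => f w - m f) l u := by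
  obtain ⟨p, l, hl, hyp, hyl, hle⟩ := hret N δ hδ
  have hag : Agree k (sigma^[l] p) z := (hyl.mono hkN).symm.trans hz
  have hpl : p.1 l = z.1 0 := by
    have := hag 0 hk
    rwa [sigma_iterate_apply, zero_add] at this
  obtain ⟨u, hu, hup⟩ := exists_splice l p z hpl
  refine ⟨l, u, hl, hyp.trans ((hup k hag).mono (by omega)), hu, ?_⟩
  linarith [abs_le.1 (abs_birkhoffSum_sub_const_le_tail h0 h1 hvar (m f) (hup k hag))]

theorem exists_coe_le_peierls (h0 : 0 < lam) (h1 : lam < 1) (hA : IsTransitive A)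
    (hvar : HasBoundedVariation lam f) {y : Shift A}
    (hret : HasOptimalReturns f y)
    (x : Shift A) : ∃ a : ℝ, (a : EReal) ≤ peierls lam f y x := by
  obtain ⟨k, q, hq0, hqk⟩ := hA.exists_path (y.1 0) (x.1 0)
  obtain ⟨r, hr, hag⟩ := exists_splice k q x hqk
  have hr0 : y.1 0 = r.1 0 := by
    rw [← hq0]
    refine hag 1 (fun i hi => ?_) 0 (by omega)
    obtain rfl : i = 0 := by omega
    rw [sigma_iterate_apply, zero_add, hqk]
  refine ⟨-1 - tail lam f 1 + birkhoffSum sigma (fun w => f w - m f) k r,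
    (coe_le_peierls_iff h0 h1).2 fun N δ hδ => ?_⟩
  obtain ⟨l, u, -, hyu, hu, hle⟩ := exists_prepend_return h0 h1 hvar hret (N := N + 1) (k := 1)
    one_pos (by omega) one_pos (z := r) fun i hi => by
      obtain rfl : i = 0 := by omega
      exact hr0
  refine ⟨k + l, u, hyu.mono (by omega), by rw [Function.iterate_add_apply, hu, hr], ?_⟩
  rw [add_comm k l, birkhoffSum_add, hu]
  linarith

/-- Modulus of continuity of the Peierls barrier: it changes by at most the `j`-th tail of the
series of variations between points with the same first `j ≥ 1` letters. The initial loop makes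
the orbit segments long enough for the endpoint to be replaced without leaving the given
neighbourhood of `y`. -/
theorem coe_sub_tail_le_peierls (h0 : 0 < lam) (h1 : lam < 1) (hvar : HasBoundedVariation lam f)
    {y : Shift A} (hret : HasOptimalReturns f y)
    {x x' : Shift A} {j : ℕ} (hj : 0 < j) (hxx : Agree j x x') {a : ℝ}
    (ha : (a : EReal) ≤ peierls lam f y x) :
    ((a - tail lam f j : ℝ) : EReal) ≤ peierls lam f y x' := by
  refine (coe_le_peierls_iff h0 h1).2 fun N δ hδ => ?_
  obtain ⟨k, hkt, hk1⟩ := (((tendsto_tail lam f).eventually_lt_const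
    (by positivity : 0 < δ / 3)).and (eventually_ge_atTop 1)).exists
  obtain ⟨n, z, hyz, hn, hz⟩ := (coe_le_peierls_iff h0 h1).1 ha k (δ / 3) (by positivity)
  obtain ⟨l, u, hl, hyu, hu, hle⟩ := exists_prepend_return h0 h1 hvar hret (N := N + k) hk1
    (by omega) (by positivity : 0 < δ / 3) hyz
  have hux : sigma^[n + l] u = x := by rw [Function.iterate_add_apply, hu, hn]
  have hux' : u.1 (n + l) = x'.1 0 := by
    rw [← hxx 0 hj, ← hux, sigma_iterate_apply, zero_add]
  obtain ⟨w, hw, huw⟩ := exists_splice (n + l) u x' hux'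
  have hag := huw j (hux ▸ hxx)
  refine ⟨n + l, w, (hyu.mono (by omega)).trans (hag.mono (by omega)), hw, ?_⟩
  have h2 := abs_birkhoffSum_sub_const_le_tail h0 h1 hvar (m f) hag
  have h3 : birkhoffSum sigma (fun w => f w - m f) (n + l) u
      = birkhoffSum sigma (fun w => f w - m f) l u
        + birkhoffSum sigma (fun w => f w - m f) n z := by
    rw [add_comm n l, birkhoffSum_add, hu]
  linarith [abs_le.1 h2]

theorem IsSubaction.birkhoffSum_le {V : Shift A → ℝ} (hV : IsSubaction f V) (n : ℕ)
    (z : Shift A) : birkhoffSum sigma (fun w => f w - m f) n z ≤ V (sigma^[n] z) - V z := by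
  induction n with
  | zero => simp
  | succ n ih =>
    rw [birkhoffSum_succ, Function.iterate_succ_apply']
    linarith [hV (sigma^[n] z)]

theorem IsSubaction.le_sub_of_coe_le_peierls (h0 : 0 < lam) (h1 : lam < 1) {V : Shift A → ℝ}
    (hV : IsSubaction f V) (hVc : Continuous V) {y x : Shift A} {a : ℝ}
    (ha : (a : EReal) ≤ peierls lam f y x) : a ≤ V x - V y := by
  refine le_of_forall_pos_le_add fun δ hδ => ?_
  obtain ⟨N, hN⟩ := exists_agree_subset
    (hVc.continuousAt.eventually_mem (Metric.ball_mem_nhds (V y) (half_pos hδ)))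
  obtain ⟨n, z, hyz, hn, hz⟩ := (coe_le_peierls_iff h0 h1).1 ha N (δ / 2) (half_pos hδ)
  have h2 := hV.birkhoffSum_le n z
  rw [hn] at h2
  have h3 : |V z - V y| < δ / 2 := hN z hyz
  linarith [abs_lt.1 h3]

theorem IsHolder.exists_tail_le (hvar : HasBoundedVariation lam f) (hf : IsHolder lam f) :
    ∃ K r : ℝ, 0 < r ∧ r < 1 ∧ ∀ k, tail lam f k ≤ K * r ^ k := by
  obtain ⟨K, r, hK, hr0, hr1, hle⟩ := hf
  refine ⟨K * r / (1 - r), r, hr0, hr1, fun k => ?_⟩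
  have hgeo : HasSum (fun i : ℕ => K * r ^ (k + 1) * r ^ i) (K * r ^ (k + 1) * (1 - r)⁻¹) :=
    (hasSum_geometric_of_lt_one hr0.le hr1).mul_left _
  have h : tail lam f k ≤ K * r ^ (k + 1) * (1 - r)⁻¹ := by
    rw [← hgeo.tsum_eq]
    refine ((summable_nat_add_iff k).2 (summable_var hvar)).tsum_le_tsum (fun i => ?_)
      hgeo.summable
    refine (ENNReal.toReal_le_of_le_ofReal (by positivity) (hle (i + k + 1) (by omega))).trans
      (le_of_eq ?_)
    ring
  refine h.trans (le_of_eq ?_)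
  rw [pow_succ]
  ring

theorem hasBoundedVariation_of_abs_sub_le (h0 : 0 < lam) (h1 : lam < 1) {S : Shift A → ℝ}
    {K r : ℝ} (hr0 : 0 < r) (hr1 : r < 1)
    (hS : ∀ j x y, 0 < j → Agree j x y → |S x - S y| ≤ K * r ^ j) :
    HasBoundedVariation lam S := by
  have hle : ∀ j, var lam S (j + 1) ≤ ENNReal.ofReal (K * r ^ (j + 1)) := fun j =>
    iSup_le fun x => iSup_le fun y => iSup_le fun hd =>
      ENNReal.ofReal_le_ofReal (hS _ x y (Nat.succ_pos j) (agree_of_d_le_pow h0 h1 hd))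
  refine (ENNReal.tsum_le_tsum hle).trans_lt (Summable.tsum_ofReal_lt_top ?_)
  exact ((summable_nat_add_iff 1).2 (summable_geometric_of_lt_one hr0.le hr1)).mul_left K

/-! ### Uniqueness of the maximizing measure and calibrated subactions -/

/-- Let `w` be a backward orbit with bounded letters along which `f = V ∘ σ - V + m(f)`. It
accumulates on a compact forward invariant set where the same equality holds, and every invariant
probability measure on that set is maximizing. So, when the maximizing measure is unique, `w`
visits every neighbourhood of every point of its support. -/
theorem exists_agree_of_backward_orbit (hm : emax f = (m f : EReal)) (hfc : Continuous f)
    {μ : Measure (Shift A)} (huniq : ∀ ν, IsMaximizing f ν → ν = μ)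
    {y : Shift A} (hy : y ∈ μ.support) {V : Shift A → ℝ} (hVc : Continuous V) {C : ℝ}
    (hVb : ∀ x, |V x| ≤ C) {w : ℕ → Shift A} {b : ℕ → ℕ} (hb : ∀ k i, (w k).1 i ≤ b i)
    (hw : ∀ k, sigma (w (k + 1)) = w k)
    (hcal : ∀ k, f (w (k + 1)) = V (sigma (w (k + 1))) - V (w (k + 1)) + m f) (N : ℕ) :
    ∃ k, Agree N y (w k) := by
  by_contra! hcon
  set Q : Set (Shift A) := {z | ∀ i, z.1 i ≤ b i} with hQ
  have hclosed : IsClosed {x : ℕ → ℕ | ∀ n, A (x n) (x (n + 1)) = 1} := by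
    rw [Set.ofPred_forall]
    refine isClosed_iInter fun n => ?_
    have hpair : Continuous fun x : ℕ → ℕ => (x n, x (n + 1)) :=
      (continuous_apply n).prodMk (continuous_apply (n + 1))
    exact (isClosed_discrete {p : ℕ × ℕ | A p.1 p.2 = 1}).preimage hpair
  have hQc : IsCompact Q := by
    have h1 : IsCompact (Set.pi Set.univ fun i => Set.Iic (b i)) :=
      isCompact_univ_pi fun i => (Set.finite_Iic (b i)).isCompact
    have h2 := hclosed.isClosedEmbedding_subtypeVal.isCompact_preimage h1
    convert! h2 using 1
    ext z
    simp [hQ, Pi.le_def]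
  set K : Set (Shift A) := {z | MapClusterPt z atTop w} with hK
  have hKclosed : IsClosed K := isClosed_setOfPred_clusterPt
  have hKQ : K ⊆ Q := fun z hz => hQc.isClosed.mem_of_mapClusterPt hz
    (Eventually.of_forall fun k => hb k)
  have hKc : IsCompact K := hQc.of_isClosed_subset hKclosed hKQ
  have hKne : K.Nonempty := by
    obtain ⟨z, -, hz⟩ := hQc.exists_mapClusterPt (u := w) (f := atTop)
      (tendsto_principal.2 (Eventually.of_forall fun k => hb k))
    exact ⟨z, hz⟩
  have hKmaps : Set.MapsTo sigma K K := by
    intro z hz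
    have h1 : MapClusterPt (sigma z) atTop (sigma ∘ w) :=
      hz.continuousAt_comp continuous_sigma.continuousAt
    refine MapClusterPt.of_comp (tendsto_sub_atTop_nat 1) (h1.congrFun ?_)
    filter_upwards [eventually_ge_atTop 1] with k hk
    obtain ⟨k, rfl⟩ := Nat.exists_eq_add_of_le' hk
    simp [hw]
  have hKcal : ∀ z ∈ K, f z = V (sigma z) - V z + m f := fun z hz => by
    refine (isClosed_eq hfc (((hVc.comp continuous_sigma).sub hVc).add
      continuous_const)).mem_of_mapClusterPt hz ?_
    filter_upwards [eventually_ge_atTop 1] with k hk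
    obtain ⟨k, rfl⟩ := Nat.exists_eq_add_of_le' hk
    exact hcal k
  have hKy : ∀ z ∈ K, ¬Agree N y z := fun z hz =>
    (isClopen_setOf_agree N y).compl.isClosed.mem_of_mapClusterPt hz
      (Eventually.of_forall hcon)
  have := isCompact_iff_compactSpace.1 hKc
  have := hKne.to_subtype
  have : TopologicalSpace.MetrizableSpace (Shift A) := IsEmbedding.subtypeVal.metrizableSpace
  have : TopologicalSpace.MetrizableSpace K := IsEmbedding.subtypeVal.metrizableSpace
  obtain ⟨ν, hν, hνT⟩ := ErgodicAux.exists_invariant_probabilityMeasure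
    (continuous_sigma.restrict hKmaps)
  set ρ : Measure (Shift A) := ν.map Subtype.val with hρ
  have hval : Measurable (Subtype.val : K → Shift A) := measurable_subtype_coe
  have hinv : IsInvariantProb ρ := by
    refine ⟨Measure.isProbabilityMeasure_map hval.aemeasurable, continuous_sigma.measurable, ?_⟩
    rw [hρ, Measure.map_map continuous_sigma.measurable hval]
    conv_rhs => rw [← hνT.map_eq, Measure.map_map hval hνT.measurable]
    rfl
  have hprob := hinv.1
  have hρK : ∀ᵐ z ∂ρ, z ∈ K := by
    exact (ae_map_iff (p := (· ∈ K)) hval.aemeasurable hKclosed.measurableSet).2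
      (Eventually.of_forall fun z => z.2)
  have hVint : Integrable V ρ := Integrable.of_bound hVc.measurable.aestronglyMeasurable C
    (Eventually.of_forall hVb)
  have hVint' : Integrable (fun z => V (sigma z)) ρ := hinv.2.integrable_comp_of_integrable hVint
  have hdiff : Integrable (fun z => V (sigma z) - V z) ρ := hVint'.sub hVint
  have hae : f =ᵐ[ρ] fun z => V (sigma z) - V z + m f := by
    filter_upwards [hρK] with z hz using hKcal z hz
  have hint : Integrable f ρ :=
    (hdiff.add (integrable_const (m f))).congr hae.symm
  have hVsig : ∫ z, V (sigma z) ∂ρ = ∫ z, V z ∂ρ := by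
    have h := integral_map (μ := ρ) continuous_sigma.measurable.aemeasurable (f := V)
      hVc.measurable.aestronglyMeasurable
    rw [hinv.2.map_eq] at h
    exact h.symm
  have hmax : IsMaximizing f ρ := by
    refine ⟨hinv, ?_⟩
    rw [eintegral_eq_integral hint, hm, integral_congr_ae hae,
      integral_add hdiff (integrable_const _), integral_sub hVint' hVint, hVsig]
    simp
  have hpos : 0 < μ {z | Agree N y z} := (Measure.mem_support_iff_forall y).1 hy _
    ((isClopen_setOf_agree N y).isOpen.mem_nhds fun i _ => rfl)
  rw [← huniq ρ hmax] at hpos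
  refine hpos.ne' (measure_mono_null (fun z hz hzK => hKy z hzK hz) hρK)

/-- If the maximizing measure is unique, then `V x - V y` is at most the Peierls barrier for every
bounded continuous calibrated subaction `V`: the sums of `f - m(f)` along a calibrated backward
orbit `w` of `x` are `V x - V (w k)`, and `w k` comes close to `y`. -/
theorem IsCalibrated.coe_sub_le_peierls (h0 : 0 < lam) (h1 : lam < 1)
    (hcoer : IsCoercive f) (hm : emax f = (m f : EReal)) (hfc : Continuous f)
    {μ : Measure (Shift A)} (huniq : ∀ ν, IsMaximizing f ν → ν = μ)
    {y : Shift A} (hy : y ∈ μ.support) {V : Shift A → ℝ} (hVc : Continuous V) {C : ℝ}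
    (hVb : ∀ x, |V x| ≤ C) (hV : IsCalibrated f V) (x : Shift A) :
    ((V x - V y : ℝ) : EReal) ≤ peierls lam f y x := by
  choose pre hpre hcal using hV.2
  set w : ℕ → Shift A := fun k => pre^[k] x with hw
  have hwsucc : ∀ k, w (k + 1) = pre (w k) := fun k => Function.iterate_succ_apply' pre k x
  have hwsig : ∀ k, sigma (w (k + 1)) = w k := fun k => by rw [hwsucc, hpre]
  have hwcal : ∀ k, f (w (k + 1)) = V (w k) - V (w (k + 1)) + m f := fun k => by
    rw [hwsucc, hcal]
  -- calibration bounds `f` below along the backward orbit, so coercivity bounds the letters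
  obtain ⟨J, hJ⟩ := hcoer.exists_forall_lt (m f - 2 * C)
  have hwb : ∀ k i, (w k).1 i ≤ J + ∑ l ∈ Finset.range (i + 1), x.1 l := by
    intro k
    induction k with
    | zero =>
      intro i
      have : x.1 i ≤ ∑ l ∈ Finset.range (i + 1), x.1 l :=
        Finset.single_le_sum (fun _ _ => Nat.zero_le _) (Finset.self_mem_range_succ i)
      exact this.trans (Nat.le_add_left _ _)
    | succ k ih =>
      intro i
      cases i with
      | zero =>
        have h : (w (k + 1)).1 0 < J := by
          refine hJ _ ?_
          rw [hwcal]
          linarith [abs_le.1 (hVb (w k)), abs_le.1 (hVb (w (k + 1)))]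
        omega
      | succ i =>
        have h : (w (k + 1)).1 (i + 1) = (w k).1 i := by rw [← hwsig k]; rfl
        rw [h, Finset.sum_range_succ]
        exact (ih i).trans (by omega)
  have hsum : ∀ k, sigma^[k] (w k) = x ∧
      birkhoffSum sigma (fun u => f u - m f) k (w k) = V x - V (w k) := by
    intro k
    induction k with
    | zero => simp [hw]
    | succ k ih =>
      rw [Function.iterate_succ_apply, birkhoffSum_succ', hwsig, ih.2, hwcal]
      exact ⟨ih.1, by ring⟩
  refine (coe_le_peierls_iff h0 h1).2 fun N δ hδ => ?_
  obtain ⟨N', hN'⟩ := exists_agree_subset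
    (hVc.continuousAt.eventually_mem (Metric.ball_mem_nhds (V y) hδ))
  obtain ⟨k, hk⟩ := exists_agree_of_backward_orbit hm hfc huniq hy hVc hVb hwb hwsig
    (fun k => by rw [hwcal, hwsig]) (N + N')
  refine ⟨k, w k, hk.mono (by omega), (hsum k).1, ?_⟩
  rw [(hsum k).2]
  have h3 : |V (w k) - V y| < δ := hN' _ (hk.mono (by omega))
  linarith [abs_lt.1 h3]

end CMS

/-! ### Finiteness, regularity and rigidity of the barrier -/

theorem theoremB (A : ℕ → ℕ → Fin 2) (hA : CMS.IsTransitive A)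
    (lam : ℝ) (hlam0 : 0 < lam) (hlam1 : lam < 1)
    (f : CMS.Shift A → ℝ) (hcoer : CMS.IsCoercive f) (hvar : CMS.HasBoundedVariation lam f)
    (μ : MeasureTheory.Measure (CMS.Shift A)) (hμ : CMS.IsMaximizing f μ)
    (ybar : CMS.Shift A) (hy : ybar ∈ μ.support) :
    ∃ S : CMS.Shift A → ℝ,
      (∀ x, CMS.peierls lam f ybar x = (S x : EReal)) ∧
      (∀ V : CMS.Shift A → ℝ, Continuous V → CMS.IsSubaction f V →
        ∀ x, S x ≤ V x - V ybar) ∧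
      (CMS.IsHolder lam f → CMS.HasBoundedVariation lam S) ∧
      ((∃! ν : MeasureTheory.Measure (CMS.Shift A), CMS.IsMaximizing f ν) →
        (∀ V : CMS.Shift A → ℝ, Continuous V → (∃ C : ℝ, ∀ x, |V x| ≤ C) →
          CMS.IsCalibrated f V → ∀ x, S x = V x - V ybar) ∧
        (∀ V W : CMS.Shift A → ℝ,
          Continuous V → (∃ C : ℝ, ∀ x, |V x| ≤ C) → CMS.IsCalibrated f V →
          Continuous W → (∃ C : ℝ, ∀ x, |W x| ≤ C) → CMS.IsCalibrated f W →
          ∃ c : ℝ, ∀ x, V x = W x + c)) := by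
  have hfc := hvar.continuous hlam0 hlam1
  obtain ⟨M, hM⟩ := hcoer.exists_le hlam0 hlam1 hA hvar
  have hm := CMS.emax_eq_m hM hA hfc.measurable
  have hret := hμ.hasOptimalReturns hM hfc.measurable hm hy
  have hfin : ∀ x, ∃ s : ℝ, CMS.peierls lam f ybar x = (s : EReal) := by
    intro x
    obtain ⟨a, ha⟩ := CMS.exists_coe_le_peierls hlam0 hlam1 hA hvar hret x
    obtain ⟨C, hC⟩ := CMS.exists_birkhoffSum_le hlam0 hlam1 hA hvar hm ybar x
    refine ⟨_, (EReal.coe_toReal ?_ (ne_bot_of_le_ne_bot (EReal.coe_ne_bot a) ha)).symm⟩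
    intro htop
    obtain ⟨n, z, hyz, hn, hz⟩ := (CMS.coe_le_peierls_iff (f := f) hlam0 hlam1
      (y := ybar) (x := x) (a := C + 2)).1 (htop ▸ le_top) 1 1 one_pos
    linarith [hC n z (hyz 0 one_pos) hn]
  choose S hS using hfin
  have hsub : ∀ V : CMS.Shift A → ℝ, Continuous V → CMS.IsSubaction f V →
      ∀ x, S x ≤ V x - V ybar := fun V hVc hV x =>
    hV.le_sub_of_coe_le_peierls hlam0 hlam1 hVc (hS x).ge
  have heq : (∃! ν : MeasureTheory.Measure (CMS.Shift A), CMS.IsMaximizing f ν) →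
      ∀ V : CMS.Shift A → ℝ, Continuous V → (∃ C : ℝ, ∀ x, |V x| ≤ C) →
        CMS.IsCalibrated f V → ∀ x, S x = V x - V ybar := by
    rintro hex V hVc ⟨C, hC⟩ hV x
    refine le_antisymm (hsub V hVc hV.1 x) ?_
    rw [← EReal.coe_le_coe_iff, ← hS]
    exact hV.coe_sub_le_peierls hlam0 hlam1 hcoer hm hfc (fun ν hν => hex.unique hν hμ) hy hVc
      hC x
  refine ⟨S, hS, hsub, fun hhol => ?_, fun hex => ⟨heq hex, ?_⟩⟩
  · obtain ⟨K, r, hr0, hr1, hle⟩ := hhol.exists_tail_le hvar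
    have hone : ∀ j x x', 0 < j → CMS.Agree j x x' → S x - S x' ≤ K * r ^ j := by
      intro j x x' hj hxx
      have h := CMS.coe_sub_tail_le_peierls hlam0 hlam1 hvar hret hj hxx (hS x).ge
      rw [hS, EReal.coe_le_coe_iff] at h
      linarith [hle j]
    exact CMS.hasBoundedVariation_of_abs_sub_le hlam0 hlam1 hr0 hr1 fun j x x' hj hxx =>
      abs_sub_le_iff.2 ⟨hone j x x' hj hxx, hone j x' x hj hxx.symm⟩
  · intro V W hVc hVb hV hWc hWb hW
    refine ⟨V ybar - W ybar, fun x => ?_⟩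
    linarith [heq hex V hVc hVb hV x, heq hex W hWc hWb hW x]
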